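/- Let $K$ be a number field with ring of integers $D=\mathcal{O}_K$, let $\mathrm{Int}(D)=\{f\in K[x] \mid f(D)\subseteq D\}$ be the ring of integer-valued polynomials on $D$, let $c$ be an element of an extension field of $K$ that is algebraic over $K$, let $F=K[c]$, and let $E=\mathcal{O}_F$ be the ring of integers of $F$ (the integral closure of $D$ in $F$). For $Q\in\mathrm{Spec}(E)$ let $E_Q\subseteq F$ be the localization of $E$ at $Q$. The $Q$-adic topology on $F$ is the topology of the $Q$-adic valuation if $Q\neq 0$, and the discrete topology if $Q=0$. Let $\mathcal{P}(c)$ be the set of those $Q\in\mathrm{Spec}(E)$ such that $c$ lies in the closure of $D$ in $F$ with respect to the $Q$-adic topology. Then the image $\mathrm{Int}(D)[c]=\{f(c)\mid f\in\mathrm{Int}(D)\}$ of $c$ under $\mathrm{Int}(D)$ is \[ \mathrm{Int}(D)[c]=\bigcap_{Q\in\mathcal{P}(c)}E_Q , \] where the intersection is taken inside $F$ (and the empty intersection is $F$). -/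

import Mathlib

open Polynomial IsDedekindDomain NumberField IntermediateField

noncomputable section

/-- The ring `Int(D)` of integer-valued polynomials on a domain `D` with quotient field `K`:
the polynomials in `K[X]` that map `D` into `D`. -/
def integerValued (D K : Type*) [CommRing D] [Field K] [Algebra D K] : Subring K[X] where
  carrier := {f | ∀ a : D, f.eval (algebraMap D K a) ∈ (algebraMap D K).range}
  mul_mem' hf hg a := by rw [eval_mul]; exact mul_mem (hf a) (hg a)
  one_mem' a := by rw [eval_one]; exact one_mem _
  add_mem' hf hg a := by rw [eval_add]; exact add_mem (hf a) (hg a)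
  zero_mem' a := by rw [eval_zero]; exact zero_mem _
  neg_mem' hf a := by rw [eval_neg]; exact neg_mem (hf a)

/-- `Int(D)[c] = {f(c) | f ∈ Int(D)}`, the image of `c` under `Int(D)`, where `c` lies in an
extension field `F` of the quotient field `K` of `D`. -/
def integerValuedImage (D K : Type*) {F : Type*} [CommRing D] [Field K] [Algebra D K]
    [Field F] [Algebra K F] (c : F) : Subring F :=
  (integerValued D K).map (aeval (R := K) c).toRingHom

/-- The localization `E_Q = {a / s | a ∈ E, s ∈ E, s ∉ Q}` of a domain `E` at a prime ideal `Q`,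
as a subring of the quotient field `F` of `E`. -/
def localizationAt {E : Type*} (F : Type*) [CommRing E] [IsDomain E] [Field F] [Algebra E F]
    [IsFractionRing E F] (Q : PrimeSpectrum E) : Subring F :=
  (Localization.subalgebra.ofField F Q.asIdeal.primeCompl
    Q.asIdeal.primeCompl_le_nonZeroDivisors).toSubring

open Classical in
/-- The `Q`-adic topology on the quotient field `F` of a Dedekind domain `E`, for a prime ideal `Q`
of `E`. If `Q` is nonzero (that is, if `Q` gives a point of the height one spectrum of `E`), this is
the topology of the `Q`-adic valuation. The `0`-adic topology is discrete, as the powers of the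
zero ideal are zero. -/
@[reducible]
def adicTopology {E : Type*} (F : Type*) [CommRing E] [IsDedekindDomain E] [Field F] [Algebra E F]
    [IsFractionRing E F] (Q : PrimeSpectrum E) : TopologicalSpace F :=
  if hQ : Q.asIdeal = ⊥ then ⊥
  else TopologicalSpace.induced
    (WithVal.toVal ((⟨Q.asIdeal, Q.isPrime, hQ⟩ : HeightOneSpectrum E).valuation F)) inferInstance

/-- The `Q`-adic closure in `F` of a subset `S` of `F`. -/
def adicClosure {E F : Type*} [CommRing E] [IsDedekindDomain E] [Field F] [Algebra E F]
    [IsFractionRing E F] (Q : PrimeSpectrum E) (S : Set F) : Set F :=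
  @closure F (adicTopology F Q) S

/-- A field generated by an algebraic element over a number field is a number field. -/
theorem numberField_adjoin_simple {K L : Type*} [Field K] [NumberField K] [Field L] [Algebra K L]
    {c : L} (hc : IsAlgebraic K c) : NumberField K⟮c⟯ := by
  have : FiniteDimensional K K⟮c⟯ := adjoin.finiteDimensional hc.isIntegral
  exact NumberField.of_module_finite K K⟮c⟯

end

/-!
Write `D = 𝓞 K`, `F = K[c]` and `E = 𝓞 F`.

A polynomial is `Q`-adically continuous and `E_Q` is closed, so `f(c) ∈ E_Q` whenever `f` is
integer-valued and `c` is a `Q`-adic limit of elements of `D`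
(`integerValuedImage_le_localizationAt`).

Conversely, let `y = g(c)` lie in `E_Q` for all `Q` for which `c` is a limit of elements of `D`.
The elements `d ∈ D` with `d * y ∈ Int(D)[c]` form an ideal, so it is enough to work at one nonzero
prime `v` of `D` at a time, and to find `f ∈ K[X]` with `f(c) = y` that is `v`-integral on `D`
(`exists_eval_le_one_and_aeval_eq`). With `m` the characteristic polynomial of `c`, one looks for
`f = g + m * h`.

* For `a ∈ D` one has `m(a) = N(a - c)`. If `m(a)` is `v`-adically small, then `a` is close to `c`
  at some prime `Q` above `v` (`exists_le_valuation_eval_charpoly`). So if `g(a)` is not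
  `v`-integral, then `m(a)` is bounded away from `0`: otherwise some elements `a` of this kind would
  tend to `c` at one of the finitely many `Q` above `v`, where `g(a)` tends to `y ∈ E_Q`.
* Hence the function on `D` that is `0` where `g` is `v`-integral and `-g / m` elsewhere is
  well approximated by functions on `D ⧸ v ^ n`. Such functions are `v`-adic uniform limits of
  polynomials over `K` (`IsDedekindDomain.HeightOneSpectrum.exists_step_approx`), and a
  sufficiently close polynomial `h` makes `g + m * h` integral on `D`
  (`IsDedekindDomain.HeightOneSpectrum.exists_eval_add_mul_le_one`).
-/

/-! ### Continuity of polynomials for a valuation -/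

section Valuation

variable {F Γ : Type*} [Field F] [LinearOrderedCommGroupWithZero Γ] (v : Valuation F Γ)

theorem Valuation.exists_eval_le (q : F[X]) :
    ∃ B : Γ, B ≠ 0 ∧ ∀ x, v x ≤ 1 → v (q.eval x) ≤ B := by
  induction q using Polynomial.induction_on' with
  | add p q hp hq =>
    obtain ⟨B, hB, h⟩ := hp
    obtain ⟨C, hC, h'⟩ := hq
    refine ⟨max B C, (lt_max_of_lt_left (zero_lt_iff.2 hB)).ne', fun x hx => ?_⟩
    rw [eval_add]
    exact v.map_add_le ((h x hx).trans (le_max_left _ _)) ((h' x hx).trans (le_max_right _ _))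
  | monomial n a =>
    refine ⟨max 1 (v a), (lt_max_of_lt_left zero_lt_one).ne', fun x hx => ?_⟩
    rw [eval_monomial, map_mul, map_pow]
    exact (mul_le_of_le_one_right' (pow_le_one' hx n)).trans (le_max_right _ _)

theorem Valuation.map_pow_sub_pow_le {x y : F} (hx : v x ≤ 1) (hy : v y ≤ 1) (n : ℕ) :
    v (x ^ n - y ^ n) ≤ v (x - y) := by
  induction n with
  | zero => simp
  | succ n ih =>
    have : x ^ (n + 1) - y ^ (n + 1) = x ^ n * (x - y) + (x ^ n - y ^ n) * y := by ring
    rw [this]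
    refine v.map_add_le ?_ ?_
    · rw [map_mul, map_pow]
      exact mul_le_of_le_one_left' (pow_le_one' hx n)
    · rw [map_mul]
      exact (mul_le_of_le_one_right' hy).trans ih

theorem Valuation.exists_eval_sub_eval_le (q : F[X]) :
    ∃ C : Γ, C ≠ 0 ∧ ∀ x y, v x ≤ 1 → v y ≤ 1 → v (q.eval x - q.eval y) ≤ C * v (x - y) := by
  induction q using Polynomial.induction_on' with
  | add p q hp hq =>
    obtain ⟨B, hB, h⟩ := hp
    obtain ⟨C, hC, h'⟩ := hq
    refine ⟨max B C, (lt_max_of_lt_left (zero_lt_iff.2 hB)).ne', fun x y hx hy => ?_⟩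
    rw [eval_add, eval_add, add_sub_add_comm]
    exact v.map_add_le ((h x y hx hy).trans (by gcongr; exact le_max_left _ _))
      ((h' x y hx hy).trans (by gcongr; exact le_max_right _ _))
  | monomial n a =>
    refine ⟨max 1 (v a), (lt_max_of_lt_left zero_lt_one).ne', fun x y hx hy => ?_⟩
    rw [eval_monomial, eval_monomial, ← mul_sub, map_mul]
    exact mul_le_mul' (le_max_right _ _) (v.map_pow_sub_pow_le hx hy n)

end Valuation

/-! ### Approximation of functions on `D ⧸ v ^ n` by polynomials -/

section Interpolation

variable {D K : Type*} [CommRing D] [IsDedekindDomain D] [Field K] [Algebra D K]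
  [IsFractionRing D K] (v : HeightOneSpectrum D)

theorem WithZero.exists_exp_neg_le {γ : WithZero (Multiplicative ℤ)} (hγ : γ ≠ 0) :
    ∃ n : ℕ, WithZero.exp (-(n : ℤ)) ≤ γ := by
  refine ⟨(-WithZero.log γ).toNat, ?_⟩
  rw [← WithZero.exp_log hγ, WithZero.exp_le_exp, WithZero.log_exp]
  lia

theorem IsDedekindDomain.HeightOneSpectrum.valuation_le_exp_iff_mem (K : Type*) [Field K] [Algebra D K]
    [IsFractionRing D K] (a : D) (n : ℕ) :
    v.valuation K (algebraMap D K a) ≤ WithZero.exp (-(n : ℤ)) ↔ a ∈ v.asIdeal ^ n := by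
  rw [v.valuation_of_algebraMap, v.intValuation_le_pow_iff_mem]

theorem IsDedekindDomain.HeightOneSpectrum.exists_div_of_valuation_le_one {x : K}
    (hx : v.valuation K x ≤ 1) :
    ∃ a s : D, s ∉ v.asIdeal ∧ x = algebraMap D K a * (algebraMap D K s)⁻¹ := by
  have h : x ∈ v.valuationSubringAtPrime K := by
    rw [v.valuationSubringAtPrime_eq_valuationSubring]
    exact hx
  obtain ⟨a, s, hs, rfl⟩ := h
  exact ⟨a, s, hs, rfl⟩

/-- The exponent is the order of the unit group of `D ⧸ v ^ n`; a `v`-adic unit of `K` is a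
quotient of two elements of `D` outside `v`. -/
theorem IsDedekindDomain.HeightOneSpectrum.exists_pow_sub_one_le [Ring.HasFiniteQuotients D] (n : ℕ) :
    ∃ M : ℕ, 0 < M ∧ ∀ u : K, v.valuation K u = 1 →
      v.valuation K (u ^ M - 1) ≤ WithZero.exp (-(n : ℤ)) := by
  have : Finite (D ⧸ v.asIdeal ^ n) :=
    Ring.HasFiniteQuotients.finiteQuotient (pow_ne_zero n v.ne_bot)
  have := v.isMaximal
  have key (s : D) (hs : s ∉ v.asIdeal) :
      s ^ Nat.card (D ⧸ v.asIdeal ^ n)ˣ - 1 ∈ v.asIdeal ^ n := by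
    rw [← Ideal.Quotient.eq, map_pow, map_one]
    obtain ⟨u, hu⟩ := Ideal.Quotient.isUnit_mk_pow_of_notMem v.asIdeal (n := n) hs
    rw [← hu, ← Units.val_pow_eq_pow_val, pow_card_eq_one', Units.val_one]
  refine ⟨Nat.card (D ⧸ v.asIdeal ^ n)ˣ, Nat.card_pos, fun u hu => ?_⟩
  obtain ⟨a, s, hs, rfl⟩ := HeightOneSpectrum.exists_div_of_valuation_le_one v hu.le
  have hs1 : v.valuation K (algebraMap D K s) = 1 := v.valuation_eq_one_iff_notMem.2 hs
  have ha1 : v.valuation K (algebraMap D K a) = 1 := by simpa [hs1] using hu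
  have ha : a ∉ v.asIdeal := v.valuation_eq_one_iff_notMem.1 ha1
  have hs0 : algebraMap D K s ≠ 0 := fun h => by simp [h] at hs1
  set M := Nat.card (D ⧸ v.asIdeal ^ n)ˣ
  have : (algebraMap D K a * (algebraMap D K s)⁻¹) ^ M - 1 =
      algebraMap D K ((a ^ M - 1) - (s ^ M - 1)) * (algebraMap D K s ^ M)⁻¹ := by
    simp only [map_sub, map_pow, map_one, mul_pow, inv_pow]
    field_simp
    ring
  rw [this, map_mul, map_inv₀, map_pow, hs1, one_pow, inv_one, mul_one,
    HeightOneSpectrum.valuation_le_exp_iff_mem]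
  exact sub_mem (key a ha) (key s hs)

/-- Up to the normalising constant, the polynomial is the product of `X - r` over representatives
`r` of the nonzero classes modulo `v ^ n`. At a point `a` of a nonzero class, the differences
`a - r` run through the nonzero classes again, except that the class of `a` is traded for `0`. -/
theorem IsDedekindDomain.HeightOneSpectrum.exists_eval_eq_one_and_lt_one
    [Ring.HasFiniteQuotients D] (n : ℕ) :
    ∃ e : K[X], ∀ a : D,
      (a ∈ v.asIdeal ^ n → v.valuation K (e.eval (algebraMap D K a)) = 1) ∧
      (a ∉ v.asIdeal ^ n → v.valuation K (e.eval (algebraMap D K a)) < 1) := by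
  classical
  have : Finite (D ⧸ v.asIdeal ^ n) :=
    Ring.HasFiniteQuotients.finiteQuotient (pow_ne_zero n v.ne_bot)
  have := Fintype.ofFinite (D ⧸ v.asIdeal ^ n)
  let r : D ⧸ v.asIdeal ^ n → D := Quotient.out
  have hr (x) : Ideal.Quotient.mk (v.asIdeal ^ n) (r x) = x := Quotient.out_eq x
  let w : D → WithZero (Multiplicative ℤ) := fun a => v.valuation K (algebraMap D K a)
  have hmem (a : D) : a ∈ v.asIdeal ^ n ↔ w a ≤ WithZero.exp (-(n : ℤ)) :=
    (HeightOneSpectrum.valuation_le_exp_iff_mem v K a n).symm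
  -- The valuation is constant on each nonzero class.
  have hw (a b : D) (hb : b ∉ v.asIdeal ^ n) (hab : a - b ∈ v.asIdeal ^ n) : w a = w b := by
    have h1 : w (a - b) < w b :=
      ((hmem _).1 hab).trans_lt (lt_of_not_ge fun h => hb ((hmem _).2 h))
    have := (v.valuation K).map_add_eq_of_lt_right (x := algebraMap D K (a - b))
      (y := algebraMap D K b) h1
    rwa [← map_add, sub_add_cancel] at this
  have hrmem (x : D ⧸ v.asIdeal ^ n) (hx : x ≠ 0) : r x ∉ v.asIdeal ^ n := by
    rwa [← Ideal.Quotient.eq_zero_iff_mem, hr]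
  have hpos (x : D ⧸ v.asIdeal ^ n) (hx : x ≠ 0) : w (r x) ≠ 0 := fun h =>
    hrmem x hx ((hmem _).2 (by rw [h]; exact zero_le))
  let C₀ := ∏ x ∈ Finset.univ.erase (0 : D ⧸ v.asIdeal ^ n), algebraMap D K (r x)
  let P : K[X] := ∏ x ∈ Finset.univ.erase (0 : D ⧸ v.asIdeal ^ n), (X - C (algebraMap D K (r x)))
  have hC₀ : v.valuation K C₀ = ∏ x ∈ Finset.univ.erase (0 : D ⧸ v.asIdeal ^ n), w (r x) := by
    simp only [C₀, map_prod, w]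
  have hC₀0 : v.valuation K C₀ ≠ 0 := by
    rw [hC₀, Finset.prod_ne_zero_iff]
    exact fun x hx => hpos x (Finset.ne_of_mem_erase hx)
  have hP (a : D) : v.valuation K (P.eval (algebraMap D K a)) =
      ∏ x ∈ Finset.univ.erase (0 : D ⧸ v.asIdeal ^ n), w (a - r x) := by
    simp only [P, eval_prod, eval_sub, eval_X, eval_C, map_prod, w, map_sub]
  refine ⟨C C₀⁻¹ * P, fun a => ⟨fun ha => ?_, fun ha => ?_⟩⟩ <;>
    rw [eval_mul, eval_C, map_mul, map_inv₀, inv_mul_eq_div]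
  · rw [div_eq_one_iff_eq hC₀0, hP, hC₀]
    refine Finset.prod_congr rfl fun x hx => ?_
    have h1 : w (-(r x)) = w (r x) := by simp only [w, map_neg, Valuation.map_neg]
    rw [← h1]
    refine hw _ _ (fun h => hrmem x (Finset.ne_of_mem_erase hx) (neg_mem_iff.1 h)) ?_
    simpa using ha
  · rw [div_lt_one₀ (zero_lt_iff.2 hC₀0), hP, hC₀]
    set x₀ := Ideal.Quotient.mk (v.asIdeal ^ n) a with hx₀
    have hx₀0 : x₀ ≠ 0 := by rwa [hx₀, Ne, Ideal.Quotient.eq_zero_iff_mem]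
    have hmem₀ : x₀ ∈ Finset.univ.erase (0 : D ⧸ v.asIdeal ^ n) := by simp [hx₀0]
    rw [← Finset.mul_prod_erase _ _ hmem₀, ← Finset.mul_prod_erase _ _ hmem₀]
    have hperm : ∏ x ∈ (Finset.univ.erase (0 : D ⧸ v.asIdeal ^ n)).erase x₀, w (a - r x) =
        ∏ x ∈ (Finset.univ.erase (0 : D ⧸ v.asIdeal ^ n)).erase x₀, w (r x) := by
      refine Finset.prod_nbij' (fun x => x₀ - x) (fun x => x₀ - x) ?_ ?_ ?_ ?_ ?_
      · intro x hx
        simp only [Finset.mem_erase, Finset.mem_univ, and_true] at hx ⊢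
        exact ⟨by simpa using hx.2, sub_ne_zero.2 (Ne.symm hx.1)⟩
      · intro x hx
        simp only [Finset.mem_erase, Finset.mem_univ, and_true] at hx ⊢
        exact ⟨by simpa using hx.2, sub_ne_zero.2 (Ne.symm hx.1)⟩
      · simp
      · simp
      · intro x hx
        simp only [Finset.mem_erase, Finset.mem_univ, and_true] at hx
        refine hw _ _ (hrmem _ (sub_ne_zero.2 (Ne.symm hx.1))) ?_
        rw [← Ideal.Quotient.eq, map_sub, hr, hr]
    rw [hperm]
    refine mul_lt_mul_of_pos_right ?_ (zero_lt_iff.2 (Finset.prod_ne_zero_iff.2 fun x hx =>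
      hpos x (Finset.ne_of_mem_erase (Finset.mem_of_mem_erase hx))))
    refine ((hmem _).1 ?_).trans_lt (lt_of_not_ge fun h => hrmem x₀ hx₀0 ((hmem _).2 h))
    rw [← Ideal.Quotient.eq, hr]

/-- High powers of a polynomial that separates `v ^ n` from its complement approximate the
indicator function of `v ^ n`, because the unit group of `D ⧸ v ^ N` has finite exponent. -/
theorem IsDedekindDomain.HeightOneSpectrum.exists_indicator_approx [Ring.HasFiniteQuotients D] (n : ℕ)
    {γ : WithZero (Multiplicative ℤ)} (hγ : γ ≠ 0) :
    ∃ e : K[X], ∀ a : D,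
      (a ∈ v.asIdeal ^ n → v.valuation K (e.eval (algebraMap D K a) - 1) ≤ γ) ∧
      (a ∉ v.asIdeal ^ n → v.valuation K (e.eval (algebraMap D K a)) ≤ γ) := by
  obtain ⟨N, hN⟩ := WithZero.exists_exp_neg_le hγ
  obtain ⟨e, he⟩ := HeightOneSpectrum.exists_eval_eq_one_and_lt_one (K := K) v n
  obtain ⟨M, hM, hM1⟩ := HeightOneSpectrum.exists_pow_sub_one_le (K := K) v N
  refine ⟨e ^ (N * M), fun a => ⟨fun ha => ?_, fun ha => ?_⟩⟩ <;> rw [eval_pow]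
  · rw [pow_mul]
    exact (hM1 _ (by rw [map_pow, (he a).1 ha, one_pow])).trans hN
  · refine le_trans ?_ hN
    have h1 := (he a).2 ha
    rw [map_pow]
    generalize v.valuation K (e.eval (algebraMap D K a)) = x at h1
    obtain rfl | hx := eq_or_ne x 0
    · obtain rfl | hN0 := eq_or_ne N 0
      · simp
      · rw [zero_pow (Nat.mul_ne_zero hN0 hM.ne')]
        exact zero_le
    have h2 : x ≤ WithZero.exp (-1 : ℤ) := by
      rw [← WithZero.exp_log hx, ← WithZero.exp_zero, WithZero.exp_lt_exp] at h1
      rw [← WithZero.exp_log hx, WithZero.exp_le_exp]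
      lia
    calc x ^ (N * M) ≤ x ^ N := pow_le_pow_right_of_le_one' h1.le (Nat.le_mul_of_pos_right _ hM)
      _ ≤ WithZero.exp (-1 : ℤ) ^ N := by gcongr
      _ = _ := by rw [← WithZero.exp_nsmul]; simp

/-- Functions on `D ⧸ v ^ n` are uniform limits of polynomials: a weak form of the `v`-adic
Stone-Weierstrass theorem. -/
theorem IsDedekindDomain.HeightOneSpectrum.exists_step_approx [Ring.HasFiniteQuotients D] (n : ℕ)
    (φ : D ⧸ v.asIdeal ^ n → K) {γ : WithZero (Multiplicative ℤ)} (hγ : γ ≠ 0) :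
    ∃ h : K[X], ∀ a : D, v.valuation K (h.eval (algebraMap D K a) -
      φ (Ideal.Quotient.mk (v.asIdeal ^ n) a)) ≤ γ := by
  classical
  have : Finite (D ⧸ v.asIdeal ^ n) :=
    Ring.HasFiniteQuotients.finiteQuotient (pow_ne_zero n v.ne_bot)
  have := Fintype.ofFinite (D ⧸ v.asIdeal ^ n)
  let r : D ⧸ v.asIdeal ^ n → D := Quotient.out
  have hr (x) : Ideal.Quotient.mk (v.asIdeal ^ n) (r x) = x := Quotient.out_eq x
  have hφ (x) : ∃ e : K[X], ∀ a : D, v.valuation K (φ x * (e.eval (algebraMap D K a) -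
      if a ∈ v.asIdeal ^ n then 1 else 0)) ≤ γ := by
    obtain h0 | h0 := eq_or_ne (φ x) 0
    · exact ⟨0, fun a => by simp [h0]⟩
    have h0' : v.valuation K (φ x) ≠ 0 := (Valuation.ne_zero_iff _).2 h0
    obtain ⟨e, he⟩ := HeightOneSpectrum.exists_indicator_approx (K := K) v n
      (div_ne_zero hγ h0')
    refine ⟨e, fun a => ?_⟩
    rw [map_mul, mul_comm, ← le_div_iff₀ (zero_lt_iff.2 h0')]
    split_ifs with ha
    · exact (he a).1 ha
    · rw [sub_zero]
      exact (he a).2 ha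
  choose e he using hφ
  refine ⟨∑ x, C (φ x) * (e x).comp (X - C (algebraMap D K (r x))), fun a => ?_⟩
  have h1 : φ (Ideal.Quotient.mk (v.asIdeal ^ n) a) =
      ∑ x, φ x * if a - r x ∈ v.asIdeal ^ n then 1 else 0 := by
    simp only [← Ideal.Quotient.eq, hr, mul_ite, mul_one, mul_zero, Finset.sum_ite_eq,
      Finset.mem_univ, if_true]
  rw [h1, eval_finsetSum, ← Finset.sum_sub_distrib]
  refine Valuation.map_sum_le _ fun x _ => ?_
  rw [eval_mul, eval_C, eval_comp, eval_sub, eval_X, eval_C, ← mul_sub, ← map_sub]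
  exact he x _

/-- If `m` is bounded away from zero where `g` is not integral, then `h` can be taken to be an
approximation of the step function that is `0` where `g` is integral and `-g / m` elsewhere. -/
theorem IsDedekindDomain.HeightOneSpectrum.exists_eval_add_mul_le_one [Ring.HasFiniteQuotients D] (g m : K[X])
    {δ : WithZero (Multiplicative ℤ)} (hδ : δ ≠ 0)
    (hm : ∀ a : D, 1 < v.valuation K (g.eval (algebraMap D K a)) →
      δ ≤ v.valuation K (m.eval (algebraMap D K a))) :
    ∃ h : K[X], ∀ a : D, v.valuation K ((g + m * h).eval (algebraMap D K a)) ≤ 1 := by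
  classical
  have hint (a : D) : v.valuation K (algebraMap D K a) ≤ 1 := v.valuation_le_one a
  obtain ⟨Bg, hBg0, hBg⟩ := (v.valuation K).exists_eval_le g
  obtain ⟨Bm, hBm0, hBm⟩ := (v.valuation K).exists_eval_le m
  obtain ⟨Lg, hLg0, hLg⟩ := (v.valuation K).exists_eval_sub_eval_le g
  obtain ⟨Lm, hLm0, hLm⟩ := (v.valuation K).exists_eval_sub_eval_le m
  -- Modulo `v ^ n`, the values of `g` agree up to integers, and `g(a) m(b) - m(a) g(b)` has
  -- valuation at most `δ`.
  obtain ⟨n, hn⟩ := WithZero.exists_exp_neg_le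
    (γ := min Lg⁻¹ (min (Bg * Lm / δ)⁻¹ (Bm * Lg / δ)⁻¹))
    (by
      refine (lt_min ?_ (lt_min ?_ ?_)).ne' <;>
        simp [zero_lt_iff, hBg0, hBm0, hLg0, hLm0, hδ])
  rw [le_min_iff, le_min_iff] at hn
  obtain ⟨hn1, hn2, hn3⟩ := hn
  let r : D ⧸ v.asIdeal ^ n → D := Quotient.out
  have hr (x) : Ideal.Quotient.mk (v.asIdeal ^ n) (r x) = x := Quotient.out_eq x
  obtain ⟨h, hh⟩ := HeightOneSpectrum.exists_step_approx v n (fun x =>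
    if v.valuation K (g.eval (algebraMap D K (r x))) ≤ 1 then 0 else
      -(g.eval (algebraMap D K (r x))) / m.eval (algebraMap D K (r x))) (inv_ne_zero hBm0)
  refine ⟨h, fun a => ?_⟩
  have har : v.valuation K (algebraMap D K a -
      algebraMap D K (r (Ideal.Quotient.mk (v.asIdeal ^ n) a))) ≤ WithZero.exp (-(n : ℤ)) := by
    rw [← map_sub, HeightOneSpectrum.valuation_le_exp_iff_mem, ← Ideal.Quotient.eq, hr]
  have hha := hh a
  generalize r (Ideal.Quotient.mk (v.asIdeal ^ n) a) = b at har hha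
  have hg := (hLg _ _ (hint a) (hint b)).trans (mul_le_mul_right har Lg)
  have hmab := (hLm _ _ (hint a) (hint b)).trans (mul_le_mul_right har Lm)
  have hmul (x : K) (hx : v.valuation K x ≤ Bm⁻¹) :
      v.valuation K (m.eval (algebraMap D K a) * x) ≤ 1 := by
    rw [map_mul, ← mul_inv_cancel₀ hBm0]
    exact mul_le_mul' (hBm _ (hint a)) hx
  rw [eval_add, eval_mul]
  split_ifs at hha with hb
  · rw [sub_zero] at hha
    refine Valuation.map_add_le _ ?_ (hmul _ hha)
    rw [← sub_add_cancel (g.eval (algebraMap D K a)) (g.eval (algebraMap D K b))]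
    refine Valuation.map_add_le _ (hg.trans ?_) hb
    calc _ ≤ Lg * Lg⁻¹ := by gcongr
      _ = 1 := mul_inv_cancel₀ hLg0
  · have hmb := hm b (not_le.1 hb)
    have hmb0' := ((zero_lt_iff.2 hδ).trans_le hmb)
    have hmb0 : m.eval (algebraMap D K b) ≠ 0 := (Valuation.ne_zero_iff _).1 hmb0'.ne'
    -- The first summand is `g(a) - m(a) g(b) / m(b)`, rewritten through the differences
    -- `m(a) - m(b)` and `g(a) - g(b)`; the second is the error of approximation.
    have key : g.eval (algebraMap D K a) + m.eval (algebraMap D K a) * h.eval (algebraMap D K a) =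
        (g.eval (algebraMap D K a) * -(m.eval (algebraMap D K a) - m.eval (algebraMap D K b)) +
          m.eval (algebraMap D K a) * (g.eval (algebraMap D K a) - g.eval (algebraMap D K b))) /
          m.eval (algebraMap D K b) +
        m.eval (algebraMap D K a) * (h.eval (algebraMap D K a) -
          -g.eval (algebraMap D K b) / m.eval (algebraMap D K b)) := by
      field_simp
      ring
    rw [key]
    refine Valuation.map_add_le _ ?_ (hmul _ hha)
    rw [map_div₀]
    refine div_le_one_of_le₀ (le_trans ?_ hmb) zero_le
    refine Valuation.map_add_le _ ?_ ?_
    · rw [map_mul, Valuation.map_neg]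
      calc _ ≤ Bg * (Lm * (Bg * Lm / δ)⁻¹) := by
            refine mul_le_mul' (hBg _ (hint a)) (hmab.trans ?_)
            gcongr
        _ = δ := by field_simp
    · rw [map_mul]
      calc _ ≤ Bm * (Lg * (Bm * Lg / δ)⁻¹) := by
            refine mul_le_mul' (hBm _ (hint a)) (hg.trans ?_)
            gcongr
        _ = δ := by field_simp

end Interpolation

/-! ### Localizations and adic closures -/

section Localization

variable {D : Type*} (K : Type*) [CommRing D] [IsDedekindDomain D] [Field K] [Algebra D K]
  [IsFractionRing D K] (v : HeightOneSpectrum D)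

/-- If `(t) = v ^ n * J` with `J` prime to `v`, any `s ∈ J` outside `v` will do. -/
theorem IsDedekindDomain.HeightOneSpectrum.exists_dvd_mul_of_valuation_le {t : D} (ht : t ≠ 0) :
    ∃ s ∉ v.asIdeal, ∀ b : D, v.valuation K (algebraMap D K b) ≤ v.valuation K (algebraMap D K t) →
      t ∣ s * b := by
  have hfm : FiniteMultiplicity v.asIdeal (Ideal.span {t}) :=
    FiniteMultiplicity.of_prime_left v.prime (by simpa using ht)
  obtain ⟨n, J, hJ, hvJ⟩ : ∃ n, ∃ J : Ideal D, Ideal.span {t} = v.asIdeal ^ n * J ∧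
      ¬v.asIdeal ∣ J := ⟨_, hfm.exists_eq_pow_mul_and_not_dvd⟩
  rw [Ideal.dvd_iff_le, SetLike.not_le_iff_exists] at hvJ
  obtain ⟨s, hsJ, hs⟩ := hvJ
  refine ⟨s, hs, fun b hb => ?_⟩
  have htn : t ∈ v.asIdeal ^ n := by
    have hle : Ideal.span {t} ≤ v.asIdeal ^ n := hJ.trans_le Ideal.mul_le_left
    exact hle (Ideal.mem_span_singleton_self t)
  have hbn : b ∈ v.asIdeal ^ n := by
    rw [← HeightOneSpectrum.valuation_le_exp_iff_mem v K] at htn ⊢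
    exact hb.trans htn
  rw [← Ideal.mem_span_singleton, hJ, mul_comm s]
  exact Ideal.mul_mem_mul hbn hsJ

theorem exists_ne_zero_algebraMap_eq_mul_eval {D : Type*} {K : Type*} [CommRing D] [IsDomain D]
    [Field K] [Algebra D K] [IsFractionRing D K] (f : K[X]) :
    ∃ t : D, t ≠ 0 ∧ ∀ a : D, ∃ b : D,
      algebraMap D K b = algebraMap D K t * f.eval (algebraMap D K a) := by
  obtain ⟨t, ht, htf⟩ := IsLocalization.integerNormalization_spec (nonZeroDivisors D) f
  refine ⟨t, nonZeroDivisors.ne_zero ht, fun a =>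
    ⟨(IsLocalization.integerNormalization (nonZeroDivisors D) f).eval a, ?_⟩⟩
  rw [← coe_aeval_eq_eval, ← aeval_algebraMap_apply, ← eval_map_algebraMap, htf, eval_smul,
    Algebra.smul_def]

theorem IsDedekindDomain.HeightOneSpectrum.exists_C_mul_mem_integerValued {f : K[X]}
    (hf : ∀ a : D, v.valuation K (f.eval (algebraMap D K a)) ≤ 1) :
    ∃ s ∉ v.asIdeal, C (algebraMap D K s) * f ∈ integerValued D K := by
  obtain ⟨t, ht0, ht⟩ := exists_ne_zero_algebraMap_eq_mul_eval (D := D) f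
  obtain ⟨s, hs, hst⟩ := HeightOneSpectrum.exists_dvd_mul_of_valuation_le K v ht0
  refine ⟨s, hs, fun a => ?_⟩
  obtain ⟨b, hbf⟩ := ht a
  obtain ⟨d, hd⟩ := hst b (by
    rw [hbf, map_mul]
    exact mul_le_of_le_one_right' (hf a))
  refine ⟨d, ?_⟩
  rw [eval_mul, eval_C]
  apply mul_left_cancel₀ (show algebraMap D K t ≠ 0 by simpa using ht0)
  rw [mul_left_comm, ← hbf, ← map_mul, ← map_mul, hd]

theorem mem_localizationAt_iff {Q : PrimeSpectrum D} (hQ : Q.asIdeal ≠ ⊥) (x : K) :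
    x ∈ localizationAt K Q ↔
      (⟨Q.asIdeal, Q.isPrime, hQ⟩ : HeightOneSpectrum D).valuation K x ≤ 1 := by
  change x ∈ (⟨Q.asIdeal, Q.isPrime, hQ⟩ : HeightOneSpectrum D).valuationSubringAtPrime K ↔ _
  rw [HeightOneSpectrum.valuationSubringAtPrime_eq_valuationSubring]
  rfl

theorem mem_localizationAt_of_eq_bot {Q : PrimeSpectrum D} (hQ : Q.asIdeal = ⊥) (x : K) :
    x ∈ localizationAt K Q := by
  obtain ⟨a, s, hs, rfl⟩ := IsFractionRing.div_surjective (A := D) x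
  exact ⟨a, s, by simpa [Ideal.primeCompl, hQ] using nonZeroDivisors.ne_zero hs, div_eq_mul_inv _ _⟩

theorem mem_adicClosure_iff {Q : PrimeSpectrum D} (hQ : Q.asIdeal ≠ ⊥) (S : Set K) (x : K) :
    x ∈ adicClosure Q S ↔ ∀ γ : WithZero (Multiplicative ℤ), γ ≠ 0 → ∃ y ∈ S,
      (⟨Q.asIdeal, Q.isPrime, hQ⟩ : HeightOneSpectrum D).valuation K (y - x) < γ := by
  set w := (⟨Q.asIdeal, Q.isPrime, hQ⟩ : HeightOneSpectrum D).valuation K with hw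
  have h1 : adicTopology K Q = TopologicalSpace.induced (WithVal.toVal w) inferInstance :=
    dif_neg hQ
  unfold adicClosure
  rw [h1, closure_induced, mem_closure_iff_nhds]
  constructor
  · intro h γ hγ
    obtain ⟨z, hz⟩ := HeightOneSpectrum.valuation_surjective K ⟨Q.asIdeal, Q.isPrime, hQ⟩ γ
    have hz0 : Valued.v (WithVal.toVal w z) ≠ 0 := by
      rw [WithVal.valued_toVal, hw, hz]; exact hγ
    obtain ⟨_, hy, y, hyS, rfl⟩ := h {y | Valued.v (y - WithVal.toVal w x) < γ} (by
      rw [Valued.mem_nhds]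
      refine ⟨Units.mk0 ((Valued.v).restrict (WithVal.toVal w z)) (by simpa using hz0), ?_⟩
      intro y hy
      rw [Set.mem_ofPred_eq, Units.val_mk0, Valuation.restrict_lt_iff,
        WithVal.valued_toVal (v := w) z, hz] at hy
      exact hy)
    exact ⟨y, hyS, hy⟩
  · intro h U hU
    rw [Valued.mem_nhds] at hU
    obtain ⟨γ, hγ⟩ := hU
    obtain ⟨y, hy, hyx⟩ := h (MonoidWithZeroHom.ValueGroup₀.embedding γ.1) (by simp)
    refine ⟨WithVal.toVal w y, hγ ?_, y, hy, rfl⟩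
    rw [Set.mem_ofPred_eq, Valuation.restrict_lt_iff_lt_embedding]
    exact hyx

end Localization

/-! ### The image of `c` and the primes of an integral extension -/

section Extension

variable {D K E F : Type*} [CommRing D] [Field K] [Algebra D K]
  [CommRing E] [IsDedekindDomain E] [Field F] [Algebra E F]
  [IsFractionRing E F] [Algebra D E] [Algebra K F]
  [Algebra D F] [IsScalarTower D E F] [IsScalarTower D K F]

/-- `Int(D)[c]` is contained in `E_Q` when `c` is a `Q`-adic limit of elements of `D`: polynomials
are `Q`-adically continuous and `E_Q` is closed. -/
theorem integerValuedImage_le_localizationAt {c : F} {Q : PrimeSpectrum E}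
    (hQ : c ∈ adicClosure Q (Set.range (algebraMap D F))) :
    integerValuedImage D K c ≤ localizationAt F Q := by
  rintro _ ⟨f, hf, rfl⟩
  by_cases hQ0 : Q.asIdeal = ⊥
  · exact mem_localizationAt_of_eq_bot F hQ0 _
  rw [mem_localizationAt_iff F hQ0]
  rw [mem_adicClosure_iff F hQ0] at hQ
  set w : HeightOneSpectrum E := ⟨Q.asIdeal, Q.isPrime, hQ0⟩
  have hint (a : D) : w.valuation F (algebraMap D F a) ≤ 1 := by
    rw [IsScalarTower.algebraMap_apply D E F]
    exact w.valuation_le_one _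
  have hc1 : w.valuation F c ≤ 1 := by
    obtain ⟨_, ⟨a, rfl⟩, ha⟩ := hQ 1 one_ne_zero
    rw [← sub_sub_cancel (algebraMap D F a) c]
    exact Valuation.map_sub_le _ (hint a) ha.le
  obtain ⟨L, hL0, hL⟩ := (w.valuation F).exists_eval_sub_eval_le (f.map (algebraMap K F))
  obtain ⟨_, ⟨a, rfl⟩, ha⟩ := hQ L⁻¹ (inv_ne_zero hL0)
  obtain ⟨b, hb⟩ := hf a
  have h2 : (f.map (algebraMap K F)).eval (algebraMap D F a) = algebraMap D F b := by
    rw [IsScalarTower.algebraMap_apply D K F, eval_map_algebraMap, aeval_algebraMap_apply,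
      coe_aeval_eq_eval, ← hb, ← IsScalarTower.algebraMap_apply]
  have h1 := hL (algebraMap D F a) c (hint a) hc1
  change w.valuation F (aeval c f) ≤ 1
  rw [← eval_map_algebraMap, ← sub_sub_cancel ((f.map (algebraMap K F)).eval (algebraMap D F a))
    ((f.map (algebraMap K F)).eval c)]
  refine Valuation.map_sub_le _ (by rw [h2]; exact hint b) (h1.trans ?_)
  calc _ ≤ L * L⁻¹ := by gcongr
    _ = 1 := mul_inv_cancel₀ hL0

/-- The elements `d` of `D` with `d * y ∈ Int(D)[c]` form an ideal, so membership of `y` in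
`Int(D)[c]` can be checked locally on `D`. -/
theorem mem_integerValuedImage_of_forall_isMaximal {c y : F}
    (h : ∀ p : Ideal D, p.IsMaximal → ∃ s ∉ p, ∃ f : K[X], aeval c f = y ∧
      C (algebraMap D K s) * f ∈ integerValued D K) :
    y ∈ integerValuedImage D K c := by
  let I : Ideal D :=
    { carrier := {d | algebraMap D F d * y ∈ integerValuedImage D K c}
      add_mem' := fun ha hb => by
        rw [Set.mem_ofPred_eq, map_add, add_mul]; exact add_mem ha hb
      zero_mem' := by simp
      smul_mem' := fun a b hb => by
        rw [Set.mem_ofPred_eq, smul_eq_mul, map_mul, mul_assoc]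
        refine mul_mem ⟨C (algebraMap D K a), fun d => ⟨a, by simp⟩, ?_⟩ hb
        simp [← IsScalarTower.algebraMap_apply] }
  have hI : I = ⊤ := by
    by_contra hI
    obtain ⟨p, hp, hIp⟩ := Ideal.exists_le_maximal I hI
    obtain ⟨s, hs, f, hf, hsf⟩ := h p hp
    refine hs (hIp (show algebraMap D F s * y ∈ integerValuedImage D K c from ⟨_, hsf, ?_⟩))
    change aeval c _ = _
    rw [map_mul, hf, aeval_C, ← IsScalarTower.algebraMap_apply]
  have h1 : (1 : D) ∈ I := hI ▸ Submodule.mem_top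
  change algebraMap D F 1 * y ∈ integerValuedImage D K c at h1
  rwa [map_one, one_mul] at h1

theorem IsDedekindDomain.HeightOneSpectrum.exists_comap_eq (E : Type*) [CommRing E]
    [IsDedekindDomain E] [Algebra D E]
    [Algebra.IsIntegral D E] [FaithfulSMul D E] (v : HeightOneSpectrum D) :
    ∃ w : HeightOneSpectrum E, w.asIdeal.comap (algebraMap D E) = v.asIdeal := by
  have := v.isPrime
  obtain ⟨Q, -, hQp, hQ⟩ := Ideal.exists_ideal_over_prime_of_isIntegral v.asIdeal (⊥ : Ideal E) (by
    change RingHom.ker _ ≤ _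
    rw [(RingHom.injective_iff_ker_eq_bot _).1 (FaithfulSMul.algebraMap_injective D E)]
    exact bot_le)
  refine ⟨⟨Q, hQp, ?_⟩, hQ⟩
  rintro rfl
  apply v.ne_bot
  rw [← hQ]
  exact Ideal.comap_bot_of_injective _ (FaithfulSMul.algebraMap_injective D E)

/-- By lying over, the ideal of denominators of `z` contracts to an ideal not contained in `v`. -/
theorem exists_mul_mem_range_of_forall_valuation_le_one [Algebra.IsIntegral D E] [FaithfulSMul D E]
    {v : HeightOneSpectrum D} {z : F}
    (hz : ∀ w : HeightOneSpectrum E, w.asIdeal.comap (algebraMap D E) = v.asIdeal →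
      w.valuation F z ≤ 1) :
    ∃ s ∉ v.asIdeal, algebraMap D F s * z ∈ (algebraMap E F).range := by
  let J : Ideal E :=
    { carrier := {e | algebraMap E F e * z ∈ (algebraMap E F).range}
      add_mem' := fun ha hb => by
        rw [Set.mem_ofPred_eq, map_add, add_mul]; exact add_mem ha hb
      zero_mem' := by simp
      smul_mem' := fun a b hb => by
        rw [Set.mem_ofPred_eq, smul_eq_mul, map_mul, mul_assoc]
        exact mul_mem ⟨a, rfl⟩ hb }
  by_contra! hcon
  have hJ : J.comap (algebraMap D E) ≤ v.asIdeal := by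
    intro s hs
    by_contra hsv
    refine hcon s hsv ?_
    rw [IsScalarTower.algebraMap_apply D E F]
    exact hs
  have := v.isPrime
  obtain ⟨Q, hQJ, hQp, hQ⟩ := Ideal.exists_ideal_over_prime_of_isIntegral v.asIdeal J hJ
  have hQ0 : Q ≠ ⊥ := by
    rintro rfl
    apply v.ne_bot
    rw [← hQ]
    exact Ideal.comap_bot_of_injective _ (FaithfulSMul.algebraMap_injective D E)
  obtain ⟨a, s, hs, has⟩ := HeightOneSpectrum.exists_div_of_valuation_le_one _ (hz ⟨Q, hQp, hQ0⟩ hQ)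
  have hs0 : algebraMap E F s ≠ 0 := fun h => hs (by
    rw [FaithfulSMul.algebraMap_eq_zero_iff] at h
    rw [h]
    exact zero_mem _)
  refine hs (hQJ (show algebraMap E F s * z ∈ (algebraMap E F).range from ⟨a, ?_⟩))
  rw [has, mul_left_comm, mul_inv_cancel₀ hs0, mul_one]

variable [IsDedekindDomain D] [IsFractionRing D K]

/-- If `x` is not `v`-integral, then `1 / x = a / s` with `a ∈ v` and `s ∉ v`, so `x` is not
integral at a prime above `v` either. -/
theorem valuation_le_one_of_comap_eq {v : HeightOneSpectrum D} {w : HeightOneSpectrum E}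
    (h : w.asIdeal.comap (algebraMap D E) = v.asIdeal) {x : K}
    (hx : w.valuation F (algebraMap K F x) ≤ 1) : v.valuation K x ≤ 1 := by
  by_contra! hlt
  have h1 : v.valuation K x⁻¹ < 1 := by
    rw [map_inv₀]
    exact inv_lt_one_of_one_lt₀ hlt
  obtain ⟨a, s, hs, has⟩ := HeightOneSpectrum.exists_div_of_valuation_le_one v h1.le
  have hs1 : v.valuation K (algebraMap D K s) = 1 := v.valuation_eq_one_iff_notMem.2 hs
  rw [has, map_mul, map_inv₀, hs1, inv_one, mul_one, v.valuation_lt_one_iff_mem, ← h,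
    Ideal.mem_comap] at h1
  rw [← h, Ideal.mem_comap] at hs
  have hs2 : w.valuation F (algebraMap E F (algebraMap D E s)) = 1 :=
    w.valuation_eq_one_iff_notMem.2 hs
  have ha2 : w.valuation F (algebraMap E F (algebraMap D E a)) < 1 :=
    (w.valuation_lt_one_iff_mem _).2 h1
  have hx0 : x ≠ 0 := fun h0 => by simp [h0] at hlt
  have hs0 : algebraMap D K s ≠ 0 := fun h => by simp [h] at hs1
  have heq : algebraMap D K s = algebraMap D K a * x := by
    rw [eq_mul_inv_iff_mul_eq₀ hs0, inv_mul_eq_iff_eq_mul₀ hx0] at has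
    rw [has, mul_comm]
  have heq2 : algebraMap E F (algebraMap D E s) =
      algebraMap E F (algebraMap D E a) * algebraMap K F x := by
    rw [← IsScalarTower.algebraMap_apply, ← IsScalarTower.algebraMap_apply,
      IsScalarTower.algebraMap_apply D K F, heq, map_mul, ← IsScalarTower.algebraMap_apply]
  rw [heq2, map_mul] at hs2
  exact absurd hs2 (mul_lt_one_of_lt_of_le ha2 hx).ne

variable [FaithfulSMul D E]

theorem valuation_norm_le_one [Algebra.IsIntegral D E] [FiniteDimensional K F]
    {v : HeightOneSpectrum D} {z : F}
    (hz : ∀ w : HeightOneSpectrum E, w.asIdeal.comap (algebraMap D E) = v.asIdeal →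
      w.valuation F z ≤ 1) :
    v.valuation K (Algebra.norm K z) ≤ 1 := by
  obtain ⟨s, hs, e, he⟩ := exists_mul_mem_range_of_forall_valuation_le_one hz
  have hint : IsIntegral D (Algebra.norm K (algebraMap E F e)) :=
    Algebra.isIntegral_norm K ((Algebra.IsIntegral.isIntegral (R := D) e).algebraMap)
  obtain ⟨d, hd⟩ := IsIntegrallyClosed.isIntegral_iff.1 hint
  rw [he, IsScalarTower.algebraMap_apply D K F, map_mul, Algebra.norm_algebraMap] at hd
  have hs1 : v.valuation K (algebraMap D K s) = 1 := v.valuation_eq_one_iff_notMem.2 hs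
  have h1 := congrArg (v.valuation K) hd
  rw [map_mul, map_pow, hs1, one_pow, one_mul] at h1
  rw [← h1]
  exact v.valuation_le_one d

/-- If `c` stays away from `a` at all primes above `v`, then `N(a - c)`, the value at `a` of the
characteristic polynomial of `c`, stays away from `0` at `v`: for a suitable constant `t`, the
quotient `t / (a - c)` is integral at all primes above `v`, and so is its norm. -/
theorem exists_le_valuation_eval_charpoly [FiniteDimensional K F] [Module.Finite D E]
    (v : HeightOneSpectrum D) (c : F)
    {γ : HeightOneSpectrum E → WithZero (Multiplicative ℤ)} (hγ : ∀ w, γ w ≠ 0) :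
    ∃ δ : WithZero (Multiplicative ℤ), δ ≠ 0 ∧ ∀ a : D,
      (∀ w : HeightOneSpectrum E, w.asIdeal.comap (algebraMap D E) = v.asIdeal →
        γ w ≤ w.valuation F (algebraMap D F a - c)) →
      δ ≤ v.valuation K ((Algebra.lmul K F c).charpoly.eval (algebraMap D K a)) := by
  have hfin : {w : HeightOneSpectrum E | w.asIdeal.comap (algebraMap D E) = v.asIdeal}.Finite := by
    have h1 := Algebra.QuasiFinite.finite_primesOver (S := E) v.asIdeal
    refine Set.Finite.of_finite_image (f := HeightOneSpectrum.asIdeal) (h1.subset ?_)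
      (fun _ _ _ _ h => HeightOneSpectrum.ext h)
    rintro _ ⟨w, hw, rfl⟩
    exact ⟨w.isPrime, ⟨hw.symm⟩⟩
  choose N hN using fun w => WithZero.exists_exp_neg_le (hγ w)
  obtain ⟨n, hn⟩ := (hfin.image N).bddAbove
  obtain ⟨π, hπ, hπ0⟩ := Submodule.exists_mem_ne_zero_of_ne_bot v.ne_bot
  refine ⟨v.valuation K ((algebraMap D K π ^ n) ^ Module.finrank K F), by simp [hπ0],
    fun a ha => ?_⟩
  have heval : (Algebra.lmul K F c).charpoly.eval (algebraMap D K a) =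
      Algebra.norm K (algebraMap D F a - c) := by
    rw [LinearMap.eval_charpoly, Algebra.norm_apply, IsScalarTower.algebraMap_apply D K F]
    congr 1
    ext x
    simp [Algebra.smul_def]
  -- There is a prime above `v`, so the bound at that prime excludes `a = c`.
  have hac : algebraMap D F a - c ≠ 0 := by
    obtain ⟨w, hw⟩ := HeightOneSpectrum.exists_comap_eq E v
    intro h0
    have := ha w hw
    rw [h0, map_zero] at this
    exact hγ w (le_zero_iff.1 this)
  have h1 : v.valuation K (Algebra.norm K
      (algebraMap K F (algebraMap D K π ^ n) / (algebraMap D F a - c))) ≤ 1 := by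
    refine valuation_norm_le_one (E := E) fun w hw => ?_
    rw [map_div₀]
    refine div_le_one_of_le₀ (le_trans ?_ (ha w hw)) zero_le
    rw [map_pow, ← IsScalarTower.algebraMap_apply, IsScalarTower.algebraMap_apply D E F, ← map_pow,
      ← map_pow]
    refine le_trans ?_ (hN w)
    rw [HeightOneSpectrum.valuation_le_exp_iff_mem]
    refine Ideal.pow_le_pow_right (hn ⟨w, hw, rfl⟩) ?_
    rw [map_pow]
    exact Ideal.pow_mem_pow (by rw [← Ideal.mem_comap, hw]; exact hπ) n
  have h2 := congrArg (fun x => v.valuation K (Algebra.norm K x))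
    (div_mul_cancel₀ (algebraMap K F (algebraMap D K π ^ n)) hac)
  simp only [map_mul (Algebra.norm K), map_mul (v.valuation K), Algebra.norm_algebraMap] at h2
  rw [heval, ← h2]
  exact mul_le_of_le_one_left' h1

/-- The local form of the inclusion of the intersection in the image of `c`. -/
theorem exists_eval_le_one_and_aeval_eq [Ring.HasFiniteQuotients D] [FiniteDimensional K F]
    [Module.Finite D E] (v : HeightOneSpectrum D) {c y : F} (hy : y ∈ Algebra.adjoin K {c})
    (h : ∀ w : HeightOneSpectrum E, w.asIdeal.comap (algebraMap D E) = v.asIdeal →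
      (∀ γ : WithZero (Multiplicative ℤ), γ ≠ 0 → ∃ a : D,
        w.valuation F (algebraMap D F a - c) < γ) → w.valuation F y ≤ 1) :
    ∃ f : K[X], (∀ a : D, v.valuation K (f.eval (algebraMap D K a)) ≤ 1) ∧ aeval c f = y := by
  rw [Algebra.adjoin_singleton_eq_range_aeval] at hy
  obtain ⟨g, rfl⟩ := hy
  -- Near `c`, the polynomial `g` is integral on `D` at every prime above `v`.
  have key (w : HeightOneSpectrum E) : ∃ γ : WithZero (Multiplicative ℤ), γ ≠ 0 ∧
      (w.asIdeal.comap (algebraMap D E) = v.asIdeal → ∀ a : D,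
        w.valuation F (algebraMap D F a - c) < γ →
          v.valuation K (g.eval (algebraMap D K a)) ≤ 1) := by
    by_cases hw : w.asIdeal.comap (algebraMap D E) = v.asIdeal
    swap
    · exact ⟨1, one_ne_zero, fun h => absurd h hw⟩
    by_cases hc : ∀ γ : WithZero (Multiplicative ℤ), γ ≠ 0 → ∃ a : D,
        w.valuation F (algebraMap D F a - c) < γ
    · obtain ⟨L, hL0, hL⟩ := (w.valuation F).exists_eval_sub_eval_le (g.map (algebraMap K F))
      have hint (a : D) : w.valuation F (algebraMap D F a) ≤ 1 := by
        rw [IsScalarTower.algebraMap_apply D E F]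
        exact w.valuation_le_one _
      have hc1 : w.valuation F c ≤ 1 := by
        obtain ⟨a, ha⟩ := hc 1 one_ne_zero
        rw [← sub_sub_cancel (algebraMap D F a) c]
        exact Valuation.map_sub_le _ (hint a) ha.le
      refine ⟨L⁻¹, inv_ne_zero hL0, fun _ a ha => valuation_le_one_of_comap_eq (F := F) hw ?_⟩
      have h1 := hL (algebraMap D F a) c (hint a) hc1
      have h2 : algebraMap K F (g.eval (algebraMap D K a)) =
          (g.map (algebraMap K F)).eval (algebraMap D F a) := by
        rw [IsScalarTower.algebraMap_apply D K F, eval_map_algebraMap, aeval_algebraMap_apply,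
          coe_aeval_eq_eval]
      rw [h2, ← sub_add_cancel (eval _ _) ((g.map (algebraMap K F)).eval c)]
      refine Valuation.map_add_le _ (h1.trans ?_) ?_
      · calc _ ≤ L * L⁻¹ := by gcongr
          _ = 1 := mul_inv_cancel₀ hL0
      · rw [eval_map_algebraMap]
        exact h w hw hc
    · push Not at hc
      obtain ⟨γ, hγ0, hγ⟩ := hc
      exact ⟨γ, hγ0, fun _ a ha => absurd ha (not_lt.2 (hγ a))⟩
  choose γ hγ0 hγ using key
  obtain ⟨δ, hδ0, hδ⟩ := exists_le_valuation_eval_charpoly (K := K) v c hγ0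
  obtain ⟨q, hq⟩ := HeightOneSpectrum.exists_eval_add_mul_le_one v g (Algebra.lmul K F c).charpoly
    hδ0 (fun a ha => hδ a fun w hw => not_lt.1 fun hlt => not_le.2 ha (hγ w hw a hlt))
  refine ⟨_, hq, ?_⟩
  rw [map_add, map_mul, Algebra.aeval_self_charpoly_lmul, zero_mul, add_zero]
  rfl

/-- The description of `Int(D)[c]` over any Dedekind domain `D` with finite quotients. -/
theorem integerValuedImage_eq_iInf_localizationAt [Ring.HasFiniteQuotients D]
    [FiniteDimensional K F] [Module.Finite D E] {c : F} (hc : Algebra.adjoin K {c} = ⊤) :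
    integerValuedImage D K c =
      ⨅ Q ∈ {Q : PrimeSpectrum E | c ∈ adicClosure Q (Set.range (algebraMap D F))},
        localizationAt F Q := by
  refine le_antisymm (le_iInf₂ fun Q hQ => integerValuedImage_le_localizationAt hQ) fun y hy => ?_
  simp only [Subring.mem_iInf] at hy
  have hyc : y ∈ Algebra.adjoin K {c} := by
    rw [hc]
    exact Algebra.mem_top
  refine mem_integerValuedImage_of_forall_isMaximal fun p hp => ?_
  by_cases hp0 : p = ⊥
  -- The zero ideal is maximal only if `D` is a field; clearing denominators then suffices.
  · rw [Algebra.adjoin_singleton_eq_range_aeval] at hyc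
    obtain ⟨g, hg⟩ := hyc
    obtain ⟨t, ht0, ht⟩ := exists_ne_zero_algebraMap_eq_mul_eval (D := D) g
    refine ⟨t, by rwa [hp0, Ideal.mem_bot], g, hg, fun a => ?_⟩
    obtain ⟨b, hb⟩ := ht a
    exact ⟨b, by rw [hb, eval_mul, eval_C]⟩
  obtain ⟨f, hf, hfy⟩ := exists_eval_le_one_and_aeval_eq (E := E) ⟨p, hp.isPrime, hp0⟩ hyc
    (fun w _ hw => by
      have := hy ⟨w.asIdeal, w.isPrime⟩ ((mem_adicClosure_iff F
        (Q := ⟨w.asIdeal, w.isPrime⟩) w.ne_bot _ _).2 fun γ hγ => by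
        obtain ⟨a, ha⟩ := hw γ hγ
        exact ⟨_, ⟨a, rfl⟩, ha⟩)
      exact (mem_localizationAt_iff F (Q := ⟨w.asIdeal, w.isPrime⟩) w.ne_bot y).1 this)
  obtain ⟨s, hs, hsf⟩ := HeightOneSpectrum.exists_C_mul_mem_integerValued K _ hf
  exact ⟨s, hs, f, hfy, hsf⟩

end Extension

/-- Here `F = K⟮c⟯`, which is `K[c]` since `c` is algebraic, `D = 𝓞 K` and `E = 𝓞 F`; the element
`AdjoinSimple.gen K c` is `c` regarded as an element of `F`. -/
theorem mainTheorem5 {K L : Type*} [Field K] [NumberField K] [Field L] [Algebra K L]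
    (c : L) (hc : IsAlgebraic K c) :
    haveI : NumberField K⟮c⟯ := numberField_adjoin_simple hc
    integerValuedImage (𝓞 K) K (AdjoinSimple.gen K c) =
      ⨅ Q ∈ {Q : PrimeSpectrum (𝓞 K⟮c⟯) | AdjoinSimple.gen K c ∈
        adicClosure Q (Set.range (algebraMap (𝓞 K) K⟮c⟯))},
        localizationAt K⟮c⟯ Q := by
  have : NumberField K⟮c⟯ := numberField_adjoin_simple hc
  have : FiniteDimensional K K⟮c⟯ := adjoin.finiteDimensional hc.isIntegral
  refine integerValuedImage_eq_iInf_localizationAt (E := 𝓞 K⟮c⟯) ?_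
  exact (adjoin.powerBasis hc.isIntegral).adjoin_gen_eq_top
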